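/- Let ${\cal U}=\{z\in\mathbb{C}:|z|\le 1\}$. For pairwise distinct points $z_0,\dots,z_{k-1}\in{\cal U}$, the Lebesgue constant of $Z_k=(z_0,\dots,z_{k-1})$ is $$\mathbb{L}_{Z_k}=\sup_{f\in C({\cal U})\setminus\{0\}}\frac{\|I_{Z_k}f\|_{L^\infty({\cal U})}}{\|f\|_{L^\infty({\cal U})}},\qquad I_{Z_k}f(z)=\sum_{j=0}^{k-1}f(z_j)\prod_{\substack{0\le i<k\\ i\ne j}}\frac{z-z_i}{z_j-z_i}.$$ A Leja sequence on ${\cal U}$ started on the boundary is a sequence $E=(e_j)_{j\ge0}$ in ${\cal U}$ with $|e_0|=1$ such that, for every $k\ge1$, $e_k$ maximizes $z\mapsto|z-e_{k-1}|\cdots|z-e_0|$ over $z\in{\cal U}$; write $E_k=(e_0,\dots,e_{k-1})$. For an integer $k\ge1$, let $\sigma_1(k)$ be the number of ones in the binary expansion of $k$ and $p(k)$ the largest integer $p$ such that $2^p$ divides $k$. Let $\mathbb{L}_{2^p}$ be the Lebesgue constant of the set of $2^p$-th roots of unity. **Theorem.** Let $E$ be any Leja sequence on ${\cal U}$ started on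 the boundary, or the sequence given by $e_k=\exp\bigl(i\pi\sum_{j=0}^n a_j2^{-j}\bigr)$ for $k=\sum_{j=0}^n a_j2^j$, $a_j\in\{0,1\}$. Then for every $k\ge1$ $$\mathbb{L}_{E_k}\le 3\sqrt{\frac{k}{2^{p(k)}}\bigl(2^{\sigma_1(k)}-1\bigr)}\;\mathbb{L}_{2^{p(k)}},$$ and in particular $$\mathbb{L}_{E_k}\le 3\sqrt{k\,\bigl(2^{\sigma_1(k)}-1\bigr)}.$$ -/

import Mathlib

noncomputable section

open scoped BigOperators

/-- The closed complex unit disc `{z : |z| ≤ 1}`. -/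
abbrev closedUnitDisc : Set ℂ := Metric.closedBall (0 : ℂ) 1

instance closedUnitDisc.instCompactSpace : CompactSpace closedUnitDisc :=
  isCompact_iff_compactSpace.mp (isCompact_closedBall (0 : ℂ) 1)

/-- The `j`-th Lagrange polynomial `∏_{i < k, i ≠ j} (x - z i) / (z j - z i)` associated with the
section `(z 0, …, z (k - 1))`, as a continuous function on `X`. -/
def lagrangeFun {X : Set ℂ} (z : ℕ → X) (k j : ℕ) : C(X, ℂ) :=
  (Lagrange.basis (Finset.range k) (fun i => (z i : ℂ)) j).toContinuousMapOn X

/-- The interpolation operator `f ↦ ∑_{j < k} f (z j) ℓ_j` on `C(X)` at the section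
`(z 0, …, z (k - 1))`. -/
def interpolationOperator {X : Set ℂ} [CompactSpace X] (z : ℕ → X) (k : ℕ) :
    C(X, ℂ) →L[ℂ] C(X, ℂ) :=
  ∑ j ∈ Finset.range k, (ContinuousMap.evalCLM ℂ (z j)).smulRight (lagrangeFun z k j)

/-- The Lebesgue constant of the section `(z 0, …, z (k - 1))`: the operator norm, with respect to
the sup norm on `C(X)`, of the interpolation operator. -/
def lebesgueConstant {X : Set ℂ} [CompactSpace X] (z : ℕ → X) (k : ℕ) : ℝ :=
  ‖interpolationOperator z k‖

/-- Leja sequences on the closed unit disc started on the unit circle: `|e 0| = 1` and, for `k ≥ 1`,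
`e k` maximizes `|x - e (k - 1)| ⋯ |x - e 0|` over the closed unit disc. -/
structure IsLejaSequence (e : ℕ → closedUnitDisc) : Prop where
  norm_zero : ‖(e 0 : ℂ)‖ = 1
  isMax : ∀ k : ℕ, 1 ≤ k → ∀ x : closedUnitDisc,
    ∏ j ∈ Finset.range k, ‖(x : ℂ) - (e j : ℂ)‖ ≤ ∏ j ∈ Finset.range k, ‖(e k : ℂ) - (e j : ℂ)‖

/-- The point `exp (i t)` of the unit circle, as a point of the closed unit disc. -/
def circlePoint (t : ℝ) : closedUnitDisc :=
  ⟨Complex.exp (t * Complex.I), by simp [Complex.norm_exp_ofReal_mul_I]⟩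

/-- The bit-reversal sequence `e k = exp (i π ∑_{j ≤ n} a_j 2^{-j})` for `k = ∑_{j ≤ n} a_j 2^j`,
`a_j ∈ {0, 1}`; the binary digit `a_j` of `k` is `k / 2 ^ j % 2`. -/
def simpleLejaSequence (k : ℕ) : closedUnitDisc :=
  circlePoint (Real.pi * ∑ j ∈ Finset.range (Nat.log 2 k + 1), ((k / 2 ^ j % 2 : ℕ) : ℝ) / 2 ^ j)

/-- The points `exp (2 π i j / N)`; for `j < N` they are the `N`-th roots of unity. -/
def rootOfUnitySequence (N j : ℕ) : closedUnitDisc :=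
  circlePoint (2 * Real.pi * j / N)

/-- The Lebesgue constant, on the closed unit disc, of the set of `N`-th roots of unity. -/
def lebesgueConstantRootsOfUnity (N : ℕ) : ℝ :=
  lebesgueConstant (rootOfUnitySequence N) N

/-- The number of ones in the binary expansion of `k`. -/
def numOnes (k : ℕ) : ℕ := (Nat.digits 2 k).count 1

end

open Polynomial Finset

/-! The maximum principle puts a Leja sequence on the unit circle. Its terms then come in opposite
pairs, and squaring the even-indexed terms yields another Leja sequence. So the section of length `2
* m` is the preimage under `z ↦ z ^ 2` of a Leja section of length `m`, and induction can follow the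
binary digits of `k`.

The ℓ¹ sum of Lagrange polynomials is controlled through the ℓ² sum `quadLebesgue`, which does not
grow under doubling (`quadLebesgue_two_mul_le`, the parallelogram law). At the next node it
satisfies an exact odd-step recursion, giving `2 ^ numOnes k - 1` (`quadLebesgue_self_le`). A
one-node update extends this to the whole disc at the cost of a factor 9 (`quadLebesgue_le`), and
Cauchy–Schwarz yields `3 * √(k * (2 ^ numOnes k - 1))`.

For `k = 2 ^ p * m`, the nodes split into `m` rotated copies of the `2 ^ p`-th roots of unity.
Interpolation factors accordingly (`interpolate_eq_sum_comp`), so only the `m`-point section of the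
`p`-fold squared sequence needs the previous bound. -/

/-- Complex-valued form of `IsLejaSequence`. -/
structure IsComplexLeja (e : ℕ → ℂ) : Prop where
  norm_le : ∀ k, ‖e k‖ ≤ 1
  norm_zero : ‖e 0‖ = 1
  isMax : ∀ k, ∀ x : ℂ, ‖x‖ ≤ 1 →
    ‖∏ j ∈ range k, (x - e j)‖ ≤ ‖∏ j ∈ range k, (e k - e j)‖

/-- The sequence `j ↦ e (2 j) ^ 2`. -/
noncomputable def sqSeq (e : ℕ → ℂ) (j : ℕ) : ℂ := e (2 * j) ^ 2

/-- A sequence on the unit circle whose consecutive terms are opposite in pairs. -/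
structure IsPaired (e : ℕ → ℂ) : Prop where
  norm_eq : ∀ k, ‖e k‖ = 1
  odd : ∀ k, e (2 * k + 1) = -e (2 * k)

/-! ### Pairing and squaring of Leja sequences -/

lemma prod_range_two_mul {M : Type*} [CommMonoid M] (F : ℕ → M) (m : ℕ) :
    ∏ i ∈ range (2 * m), F i = ∏ i ∈ range m, F (2 * i) * F (2 * i + 1) := by
  induction m with
  | zero => simp
  | succ m ih =>
    rw [show 2 * (m + 1) = 2 * m + 1 + 1 by ring, prod_range_succ, prod_range_succ, ih,
      prod_range_succ, mul_assoc]

lemma sum_range_two_mul {M : Type*} [AddCommMonoid M] (F : ℕ → M) (m : ℕ) :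
    ∑ i ∈ range (2 * m), F i = ∑ i ∈ range m, (F (2 * i) + F (2 * i + 1)) := by
  induction m with
  | zero => simp
  | succ m ih =>
    rw [show 2 * (m + 1) = 2 * m + 1 + 1 by ring, sum_range_succ, sum_range_succ, ih,
      sum_range_succ, add_assoc]

lemma prod_sub_two_mul {e : ℕ → ℂ} {m : ℕ} (h : ∀ k < m, e (2 * k + 1) = -e (2 * k)) (z : ℂ) :
    ∏ i ∈ range (2 * m), (z - e i) = ∏ i ∈ range m, (z ^ 2 - sqSeq e i) := by
  rw [prod_range_two_mul]
  refine prod_congr rfl fun i hi => ?_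
  rw [h i (mem_range.1 hi), sqSeq]
  ring

namespace IsComplexLeja

variable {e : ℕ → ℂ}

lemma max_pos (h : IsComplexLeja e) (k : ℕ) : 0 < ‖∏ j ∈ range k, (e k - e j)‖ := by
  have hinf : (Metric.closedBall (0 : ℂ) 1).Infinite := by
    refine Set.Infinite.mono Metric.ball_subset_closedBall ?_
    exact infinite_of_mem_nhds 0 (Metric.ball_mem_nhds 0 one_pos)
  obtain ⟨x, hx, hx'⟩ := hinf.exists_notMem_finset ((range k).image e)
  refine lt_of_lt_of_le ?_ (h.isMax k x (by simpa using hx))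
  rw [norm_pos_iff, prod_ne_zero_iff]
  intro j hj h0
  exact hx' (mem_image.2 ⟨j, hj, (sub_eq_zero.1 h0).symm⟩)

lemma ne_of_lt (h : IsComplexLeja e) {j k : ℕ} (hjk : j < k) : e k ≠ e j := by
  have := norm_pos_iff.1 (h.max_pos k)
  rw [prod_ne_zero_iff] at this
  exact sub_ne_zero.1 (this j (mem_range.2 hjk))

lemma injective (h : IsComplexLeja e) : Function.Injective e := by
  intro i j hij
  rcases lt_trichotomy i j with hlt | rfl | hlt
  · exact absurd hij.symm (h.ne_of_lt hlt)
  · rfl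
  · exact absurd hij (h.ne_of_lt hlt)

/-- An interior maximum would make the product of constant modulus on the closed disc, yet it
vanishes at `e 0` and is nonzero at `e k`. -/
lemma norm_eq (h : IsComplexLeja e) (k : ℕ) : ‖e k‖ = 1 := by
  rcases Nat.eq_zero_or_pos k with rfl | hk
  · exact h.norm_zero
  by_contra hne
  have hlt : e k ∈ Metric.ball (0 : ℂ) 1 := by
    simpa using lt_of_le_of_ne (h.norm_le k) hne
  have hd : Differentiable ℂ fun z : ℂ => ∏ j ∈ range k, (z - e j) := by fun_prop
  have heq := Complex.eqOn_closure_of_isPreconnected_of_isMaxOn_norm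
    (convex_ball (0 : ℂ) 1).isPreconnected Metric.isOpen_ball hd.diffContOnCl hlt
    (fun x hx => h.isMax k x (by simpa using (mem_ball_zero_iff.1 hx).le))
  have h0 : e 0 ∈ closure (Metric.ball (0 : ℂ) 1) := by
    rw [closure_ball _ one_ne_zero]
    simpa using h.norm_le 0
  have h1 := heq h0
  have h2 : ∏ j ∈ range k, (e 0 - e j) = 0 := prod_eq_zero (mem_range.2 hk) (sub_self _)
  simp only [h2, Function.const_apply] at h1
  have h3 := h.max_pos k
  rw [← h1] at h3
  simp at h3

end IsComplexLeja

lemma eq_neg_of_two_le_norm_sub {x y : ℂ} (hx : ‖x‖ ≤ 1) (hy : ‖y‖ ≤ 1) (h : 2 ≤ ‖x - y‖) :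
    x = -y := by
  have h1 := parallelogram_law_with_norm ℝ x y
  have h2 : ‖x + y‖ * ‖x + y‖ ≤ 0 := by nlinarith [norm_nonneg x, norm_nonneg y]
  have h3 : ‖x + y‖ = 0 := by nlinarith [norm_nonneg (x + y)]
  exact eq_neg_of_add_eq_zero_left (norm_eq_zero.1 h3)

namespace IsComplexLeja

variable {e : ℕ → ℂ}

/-- Over paired nodes the product depends only on `z ^ 2`, and every point of the disc is the square
of a point of the disc. -/
lemma sqSeq_isMax (h : IsComplexLeja e) {m : ℕ} (ho : ∀ k < m, e (2 * k + 1) = -e (2 * k))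
    (x : ℂ) (hx : ‖x‖ ≤ 1) :
    ‖∏ j ∈ range m, (x - sqSeq e j)‖ ≤ ‖∏ j ∈ range m, (sqSeq e m - sqSeq e j)‖ := by
  obtain ⟨y, rfl⟩ := IsSquare.exists_sq x (IsAlgClosed.exists_eq_mul_self x)
  have hy : ‖y‖ ≤ 1 := by
    rw [norm_pow] at hx
    exact (sq_le_one_iff₀ (norm_nonneg _)).1 hx
  have := h.isMax (2 * m) y hy
  rwa [prod_sub_two_mul ho, prod_sub_two_mul ho] at this

lemma isPaired (h : IsComplexLeja e) : IsPaired e := by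
  refine ⟨h.norm_eq, fun k => ?_⟩
  induction k using Nat.strong_induction_on with
  | _ m ih =>
    -- Testing the antipode of `e (2 * m)` forces `e (2 * m + 1)` to lie at distance at least 2 from
    -- `e (2 * m)`, because the product over the earlier nodes is already maximal at `e (2 * m)`.
    have h1 := h.isMax (2 * m + 1) (-e (2 * m)) (by simpa using h.norm_le (2 * m))
    rw [prod_range_succ, prod_range_succ, prod_sub_two_mul ih, prod_sub_two_mul ih, neg_sq,
      norm_mul, norm_mul] at h1
    have h2 := h.sqSeq_isMax ih (e (2 * m + 1) ^ 2) (by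
      rw [norm_pow]; exact pow_le_one₀ (norm_nonneg _) (h.norm_le _))
    have h3 := h.max_pos (2 * m)
    rw [prod_sub_two_mul ih] at h3
    have h4 : ‖-e (2 * m) - e (2 * m)‖ = 2 := by
      rw [show -e (2 * m) - e (2 * m) = -2 * e (2 * m) by ring, norm_mul, h.norm_eq]
      simp
    rw [h4] at h1
    refine eq_neg_of_two_le_norm_sub (h.norm_le _) (h.norm_le _) ?_
    refine le_of_mul_le_mul_left (h1.trans ?_) h3
    exact mul_le_mul_of_nonneg_right h2 (norm_nonneg _)

lemma isComplexLeja_sqSeq (h : IsComplexLeja e) : IsComplexLeja (sqSeq e) := by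
  have hn : ∀ k, ‖sqSeq e k‖ = 1 := fun k => by simp [sqSeq, h.norm_eq]
  exact ⟨fun k => (hn k).le, hn 0, fun m x hx => h.sqSeq_isMax (fun k _ => h.isPaired.odd k) x hx⟩

lemma iterate_sqSeq (h : IsComplexLeja e) (p : ℕ) : IsComplexLeja (sqSeq^[p] e) := by
  induction p with
  | zero => exact h
  | succ p ih => rw [Function.iterate_succ_apply']; exact ih.isComplexLeja_sqSeq

end IsComplexLeja

lemma IsPaired.sq_eq {e : ℕ → ℂ} (h : IsPaired e) (i : ℕ) : e i ^ 2 = sqSeq e (i / 2) := by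
  rw [sqSeq]
  rcases Nat.even_or_odd' i with ⟨j, rfl | rfl⟩
  · rw [Nat.mul_div_cancel_left _ two_pos]
  · rw [h.odd, neg_sq, show (2 * j + 1) / 2 = j by omega]

lemma IsComplexLeja.pow_two_pow {e : ℕ → ℂ} (h : IsComplexLeja e) (p i : ℕ) :
    e i ^ 2 ^ p = (sqSeq^[p] e) (i / 2 ^ p) := by
  induction p with
  | zero => simp
  | succ p ih =>
    rw [Function.iterate_succ_apply', pow_succ, pow_mul, ih, (h.iterate_sqSeq p).isPaired.sq_eq,
      Nat.div_div_eq_div_mul]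

/-- A paired sequence reproduced by `sqSeq` is a Leja sequence. -/
lemma IsPaired.isComplexLeja {e : ℕ → ℂ} (h : IsPaired e) (hs : sqSeq e = e) :
    IsComplexLeja e := by
  refine ⟨fun k => (h.norm_eq k).le, h.norm_eq 0, fun k => ?_⟩
  induction k using Nat.strong_induction_on with
  | _ k ih =>
    intro x hx
    have hx2 : ‖x ^ 2‖ ≤ 1 := by rw [norm_pow]; exact pow_le_one₀ (norm_nonneg _) hx
    have hsq : ∀ i, e (2 * i) ^ 2 = e i := fun i => congrFun hs i
    rcases Nat.even_or_odd' k with ⟨m, rfl | rfl⟩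
    · rcases Nat.eq_zero_or_pos m with rfl | hm
      · simp
      rw [prod_sub_two_mul fun k _ => h.odd k, prod_sub_two_mul fun k _ => h.odd k, hs, hsq]
      exact ih m (by omega) _ hx2
    · rw [prod_range_succ, prod_range_succ, prod_sub_two_mul fun k _ => h.odd k,
        prod_sub_two_mul fun k _ => h.odd k, hs, h.odd, neg_sq, hsq, norm_mul, norm_mul]
      refine mul_le_mul (ih m (by omega) _ hx2) ?_ (norm_nonneg _) (norm_nonneg _)
      rw [show -e (2 * m) - e (2 * m) = -2 * e (2 * m) by ring, norm_mul, h.norm_eq]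
      refine (norm_sub_le _ _).trans ?_
      rw [h.norm_eq]
      norm_num
      linarith

/-! ### Lagrange basis polynomials -/

/-- The value at `z` of the `j`-th Lagrange polynomial at the nodes `e 0, …, e (k - 1)`. -/
noncomputable def lagrangeEval (e : ℕ → ℂ) (k j : ℕ) (z : ℂ) : ℂ :=
  (Lagrange.basis (range k) e j).eval z

/-- The square of the quadratic Lebesgue function. -/
noncomputable def quadLebesgue (e : ℕ → ℂ) (k : ℕ) (z : ℂ) : ℝ :=
  ∑ j ∈ range k, ‖lagrangeEval e k j z‖ ^ 2

lemma lagrangeEval_eq_prod (e : ℕ → ℂ) (k j : ℕ) (z : ℂ) :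
    lagrangeEval e k j z = ∏ i ∈ range k, if i = j then 1 else (z - e i) / (e j - e i) := by
  have : ∀ s : Finset ℕ, (∏ i ∈ s, if i = j then 1 else (z - e i) / (e j - e i)) =
      ∏ i ∈ s.erase j, (z - e i) / (e j - e i) := by
    intro s
    rw [← filter_ne', prod_filter]
    exact prod_congr rfl fun i _ => by by_cases h : i = j <;> simp [h]
  rw [this, lagrangeEval, Lagrange.basis, eval_prod]
  refine prod_congr rfl fun i _ => ?_
  simp [Lagrange.basisDivisor, div_eq_inv_mul]

lemma lagrangeEval_succ_of_lt (e : ℕ → ℂ) {k j : ℕ} (hj : j < k) (z : ℂ) :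
    lagrangeEval e (k + 1) j z = lagrangeEval e k j z * ((z - e k) / (e j - e k)) := by
  rw [lagrangeEval_eq_prod, lagrangeEval_eq_prod, prod_range_succ, if_neg hj.ne']

lemma lagrangeEval_last (e : ℕ → ℂ) (k : ℕ) (z : ℂ) :
    lagrangeEval e (k + 1) k z =
      (∏ i ∈ range k, (z - e i)) / ∏ i ∈ range k, (e k - e i) := by
  rw [lagrangeEval_eq_prod, prod_range_succ, if_pos rfl, mul_one, ← prod_div_distrib]
  exact prod_congr rfl fun i hi => if_neg (mem_range.1 hi).ne

lemma lagrangeEval_mul_sub (e : ℕ → ℂ) {k j : ℕ} (hj : j < k) (z : ℂ) :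
    lagrangeEval e k j z * (z - e j) =
      (∏ i ∈ range k, (z - e i)) / ∏ i ∈ range k, (if i = j then 1 else e j - e i) := by
  rw [lagrangeEval_eq_prod, ← prod_div_distrib]
  have : z - e j = ∏ i ∈ range k, if i = j then z - e i else 1 := by
    rw [prod_ite_eq' (range k) j fun i => z - e i, if_pos (mem_range.2 hj)]
  rw [this, ← prod_mul_distrib]
  exact prod_congr rfl fun i _ => by by_cases h : i = j <;> simp [h]

/-- Newton-style update: subtracting a multiple of the last basis polynomial creates the zero at `e
k`. That polynomial is bounded by 1 on the disc for a Leja sequence, which makes this form useful.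
-/
lemma lagrangeEval_succ_eq_sub {e : ℕ → ℂ} (he : Function.Injective e) {k j : ℕ} (hj : j < k)
    (z : ℂ) : lagrangeEval e (k + 1) j z =
      lagrangeEval e k j z - lagrangeEval e k j (e k) * lagrangeEval e (k + 1) k z := by
  have h1 : e j - e k ≠ 0 := sub_ne_zero.2 fun h => hj.ne (he h)
  have h1' : e k - e j ≠ 0 := sub_ne_zero.2 fun h => hj.ne' (he h)
  have h2 : ∏ i ∈ range k, (e k - e i) ≠ 0 := prod_ne_zero_iff.2 fun i hi =>
    sub_ne_zero.2 fun h => (mem_range.1 hi).ne' (he h)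
  have h3 : lagrangeEval e k j (e k) = (∏ i ∈ range k, (e k - e i)) /
      (∏ i ∈ range k, (if i = j then 1 else e j - e i)) / (e k - e j) := by
    rw [← lagrangeEval_mul_sub e hj, mul_div_cancel_right₀ _ h1']
  have h4 : lagrangeEval e k j (e k) * lagrangeEval e (k + 1) k z =
      lagrangeEval e k j z * (z - e j) / (e k - e j) := by
    rw [h3, lagrangeEval_last, lagrangeEval_mul_sub e hj]
    field_simp
  rw [h4, lagrangeEval_succ_of_lt e hj]
  field_simp
  ring

/-! ### Doubling relations for the quadratic Lebesgue function -/

section Paired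

variable {e : ℕ → ℂ}

lemma IsPaired.ne_zero (h : IsPaired e) (k : ℕ) : e k ≠ 0 := by
  intro h0
  have := h.norm_eq k
  simp [h0] at this

lemma lagrangeEval_two_mul (h : IsPaired e) {m j : ℕ} (hj : j < m)
    (z : ℂ) : lagrangeEval e (2 * m) (2 * j) z =
      lagrangeEval (sqSeq e) m j (z ^ 2) * ((z + e (2 * j)) / (2 * e (2 * j))) := by
  have : (z + e (2 * j)) / (2 * e (2 * j)) =
      ∏ i ∈ range m, if i = j then (z + e (2 * j)) / (2 * e (2 * j)) else 1 := by
    rw [prod_ite_eq' (range m) j fun _ => (z + e (2 * j)) / (2 * e (2 * j)),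
      if_pos (mem_range.2 hj)]
  rw [this, lagrangeEval_eq_prod, lagrangeEval_eq_prod, ← prod_mul_distrib, prod_range_two_mul]
  refine prod_congr rfl fun i _ => ?_
  have h1 : 2 * i + 1 ≠ 2 * j := by omega
  by_cases hij : i = j
  · subst hij
    rw [if_pos rfl, if_neg h1, if_pos rfl, if_pos rfl, h.odd, one_mul, one_mul, sub_neg_eq_add,
      sub_neg_eq_add, ← two_mul]
  · have h2 : 2 * i ≠ 2 * j := by omega
    simp only [h1, h2, hij, if_false, h.odd, mul_one, sqSeq, div_mul_div_comm]
    congr 1 <;> ring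

lemma lagrangeEval_two_mul_add_one (h : IsPaired e) {m j : ℕ}
    (hj : j < m) (z : ℂ) : lagrangeEval e (2 * m) (2 * j + 1) z =
      lagrangeEval (sqSeq e) m j (z ^ 2) * ((e (2 * j) - z) / (2 * e (2 * j))) := by
  have : (e (2 * j) - z) / (2 * e (2 * j)) =
      ∏ i ∈ range m, if i = j then (e (2 * j) - z) / (2 * e (2 * j)) else 1 := by
    rw [prod_ite_eq' (range m) j fun _ => (e (2 * j) - z) / (2 * e (2 * j)),
      if_pos (mem_range.2 hj)]
  rw [this, lagrangeEval_eq_prod, lagrangeEval_eq_prod, ← prod_mul_distrib, prod_range_two_mul]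
  refine prod_congr rfl fun i _ => ?_
  have h1 : 2 * i ≠ 2 * j + 1 := by omega
  by_cases hij : i = j
  · subst hij
    rw [if_neg h1, if_pos rfl, if_pos rfl, if_pos rfl, h.odd, one_mul, mul_one, ← neg_div_neg_eq]
    congr 1 <;> ring
  · have h2 : 2 * i + 1 ≠ 2 * j + 1 := by omega
    simp only [h1, h2, hij, if_false, h.odd, mul_one, sqSeq, div_mul_div_comm]
    congr 1 <;> ring

/-- Each pair contributes the weight `(‖z + a‖ ^ 2 + ‖z - a‖ ^ 2) / 4 = (‖z‖ ^ 2 + 1) / 2 ≤ 1`, with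
`a = e (2 * j)`. -/
lemma quadLebesgue_two_mul_le (h : IsPaired e) (m : ℕ) {z : ℂ}
    (hz : ‖z‖ ≤ 1) : quadLebesgue e (2 * m) z ≤ quadLebesgue (sqSeq e) m (z ^ 2) := by
  rw [quadLebesgue, sum_range_two_mul, quadLebesgue]
  refine sum_le_sum fun j hj => ?_
  rw [lagrangeEval_two_mul h (mem_range.1 hj), lagrangeEval_two_mul_add_one h
    (mem_range.1 hj), norm_mul, norm_mul, norm_div, norm_div, norm_mul, h.norm_eq]
  have h1 := parallelogram_law_with_norm ℝ z (e (2 * j))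
  rw [h.norm_eq] at h1
  rw [norm_sub_rev (e (2 * j)) z]
  have h2 : ‖z‖ * ‖z‖ ≤ 1 := by nlinarith [norm_nonneg z]
  have h3 : ‖(2 : ℂ)‖ = 2 := by simp
  rw [h3]
  have h4 := sq_nonneg ‖lagrangeEval (sqSeq e) m j (z ^ 2)‖
  nlinarith

/-- The last basis polynomial takes the value 1 up to modulus. For the others, the linear factors
collapse to `∓e (2 * m) / e (2 * j)`, of modulus 1, so both members of a pair contribute equally. -/
lemma quadLebesgue_odd_self (h : IsPaired e) (he : Function.Injective e) (m : ℕ) :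
    quadLebesgue e (2 * m + 1) (e (2 * m + 1)) =
      1 + 2 * quadLebesgue (sqSeq e) m (sqSeq e m) := by
  have hsq : e (2 * m + 1) ^ 2 = sqSeq e m := by rw [h.odd, neg_sq, sqSeq]
  rw [quadLebesgue, sum_range_succ, sum_range_two_mul, quadLebesgue, add_comm, mul_sum]
  congr 1
  · have h0 : ∏ i ∈ range (2 * m), (e (2 * m) - e i) ≠ 0 := prod_ne_zero_iff.2 fun i hi =>
      sub_ne_zero.2 fun h => (mem_range.1 hi).ne' (he h)
    rw [prod_sub_two_mul fun k _ => h.odd k] at h0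
    rw [lagrangeEval_last, prod_sub_two_mul fun k _ => h.odd k,
      prod_sub_two_mul fun k _ => h.odd k, hsq]
    change ∏ i ∈ range m, (sqSeq e m - sqSeq e i) ≠ 0 at h0
    change ‖_ / ∏ i ∈ range m, (sqSeq e m - sqSeq e i)‖ ^ 2 = 1
    rw [div_self h0, norm_one, one_pow]
  · refine sum_congr rfl fun j hj => ?_
    have hj := mem_range.1 hj
    rw [lagrangeEval_succ_of_lt e (by omega), lagrangeEval_succ_of_lt e (by omega),
      lagrangeEval_two_mul h hj, lagrangeEval_two_mul_add_one h hj, hsq, h.odd, h.odd]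
    have h1 : e (2 * j) - e (2 * m) ≠ 0 := sub_ne_zero.2 fun h => by have := he h; omega
    have h2 : e (2 * j) + e (2 * m) ≠ 0 := by
      intro h'
      have : e (2 * j + 1) = e (2 * m) := by rw [h.odd]; linear_combination -h'
      have := he this
      omega
    have h3 := h.ne_zero (2 * j)
    have h4 : (-e (2 * m) + e (2 * j)) / (2 * e (2 * j)) *
        ((-e (2 * m) - e (2 * m)) / (e (2 * j) - e (2 * m))) = -e (2 * m) / e (2 * j) := by
      field_simp
      ring
    have h5 : (e (2 * j) - -e (2 * m)) / (2 * e (2 * j)) *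
        ((-e (2 * m) - e (2 * m)) / (-e (2 * j) - e (2 * m))) = e (2 * m) / e (2 * j) := by
      rw [show -e (2 * j) - e (2 * m) = -(e (2 * j) + e (2 * m)) by ring]
      field_simp
      ring
    rw [mul_assoc, mul_assoc, h4, h5]
    simp only [norm_mul, norm_div, norm_neg, h.norm_eq]
    ring

end Paired

/-! ### Binary induction for the quadratic bounds -/

lemma numOnes_two_mul (m : ℕ) : numOnes (2 * m) = numOnes m := by
  rcases Nat.eq_zero_or_pos m with rfl | hm
  · simp
  · rw [numOnes, numOnes, Nat.digits_def' (by norm_num) (by omega)]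
    simp

lemma numOnes_two_mul_add_one (m : ℕ) : numOnes (2 * m + 1) = numOnes m + 1 := by
  rw [numOnes, numOnes, Nat.digits_def' (by norm_num) (by omega)]
  simp [show (2 * m + 1) % 2 = 1 by omega, show (2 * m + 1) / 2 = m by omega]

lemma numOnes_two_pow_mul (p m : ℕ) : numOnes (2 ^ p * m) = numOnes m := by
  induction p with
  | zero => simp
  | succ p ih => rw [pow_succ', mul_assoc, numOnes_two_mul, ih]

lemma quadLebesgue_self_le {e : ℕ → ℂ} (h : IsComplexLeja e) (k : ℕ) :
    quadLebesgue e k (e k) ≤ 2 ^ numOnes k - 1 := by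
  induction k using Nat.strong_induction_on generalizing e with
  | _ k ih =>
    rcases Nat.even_or_odd' k with ⟨m, rfl | rfl⟩
    · rcases Nat.eq_zero_or_pos m with rfl | hm
      · simp [quadLebesgue, numOnes]
      rw [numOnes_two_mul]
      exact (quadLebesgue_two_mul_le h.isPaired m (h.norm_le _)).trans
        (ih m (by omega) h.isComplexLeja_sqSeq)
    · rw [numOnes_two_mul_add_one, quadLebesgue_odd_self h.isPaired h.injective, pow_succ]
      linarith [ih m (by omega) h.isComplexLeja_sqSeq]

/-- The weights are chosen so that the constant 9 survives an odd step: `4 / 3 * 9 + 4 = 16 ≤ 2 *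
9`. -/
lemma norm_sub_sq_le_four_thirds (a b : ℂ) : ‖a - b‖ ^ 2 ≤ 4 / 3 * ‖a‖ ^ 2 + 4 * ‖b‖ ^ 2 := by
  have h := pow_le_pow_left₀ (norm_nonneg _) (norm_sub_le a b) 2
  nlinarith [sq_nonneg (‖a‖ - 3 * ‖b‖)]

lemma IsComplexLeja.norm_lagrangeEval_last_le {e : ℕ → ℂ} (h : IsComplexLeja e) (k : ℕ) {z : ℂ}
    (hz : ‖z‖ ≤ 1) : ‖lagrangeEval e (k + 1) k z‖ ≤ 1 := by
  rw [lagrangeEval_last, norm_div, div_le_one (h.max_pos k)]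
  exact h.isMax k z hz

lemma quadLebesgue_succ_le {e : ℕ → ℂ} (h : IsComplexLeja e) (k : ℕ) {z : ℂ} (hz : ‖z‖ ≤ 1) :
    quadLebesgue e (k + 1) z ≤ 4 / 3 * quadLebesgue e k z + 4 * quadLebesgue e k (e k) + 1 := by
  have h1 := h.norm_lagrangeEval_last_le k hz
  rw [quadLebesgue, sum_range_succ, quadLebesgue, quadLebesgue, mul_sum, mul_sum,
    ← sum_add_distrib]
  refine add_le_add (sum_le_sum fun j hj => ?_) (pow_le_one₀ (norm_nonneg _) h1)
  rw [lagrangeEval_succ_eq_sub h.injective (mem_range.1 hj)]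
  refine (norm_sub_sq_le_four_thirds _ _).trans ?_
  rw [norm_mul, mul_pow]
  have h2 := pow_le_one₀ (n := 2) (norm_nonneg _) h1
  have h3 := mul_le_of_le_one_right (sq_nonneg ‖lagrangeEval e k j (e k)‖) h2
  linarith

lemma quadLebesgue_le {e : ℕ → ℂ} (h : IsComplexLeja e) (k : ℕ) {z : ℂ} (hz : ‖z‖ ≤ 1) :
    quadLebesgue e k z ≤ 9 * (2 ^ numOnes k - 1) := by
  induction k using Nat.strong_induction_on generalizing e z with
  | _ k ih =>
    have hz2 : ‖z ^ 2‖ ≤ 1 := by rw [norm_pow]; exact pow_le_one₀ (norm_nonneg _) hz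
    rcases Nat.even_or_odd' k with ⟨m, rfl | rfl⟩
    · rcases Nat.eq_zero_or_pos m with rfl | hm
      · simp [quadLebesgue, numOnes]
      rw [numOnes_two_mul]
      exact (quadLebesgue_two_mul_le h.isPaired m hz).trans
        (ih m (by omega) h.isComplexLeja_sqSeq hz2)
    · have h1 := quadLebesgue_succ_le h (2 * m) hz
      have h2 := quadLebesgue_two_mul_le h.isPaired m hz
      have h3 := ih m (by omega) h.isComplexLeja_sqSeq hz2
      have h4 := quadLebesgue_self_le h (2 * m)
      have h5 : (1 : ℝ) ≤ 2 ^ numOnes m := one_le_pow₀ (by norm_num)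
      rw [numOnes_two_mul] at h4
      rw [numOnes_two_mul_add_one, pow_succ]
      linarith

lemma sum_norm_lagrangeEval_le {e : ℕ → ℂ} (h : IsComplexLeja e) (k : ℕ) {z : ℂ}
    (hz : ‖z‖ ≤ 1) :
    ∑ j ∈ range k, ‖lagrangeEval e k j z‖ ≤ 3 * Real.sqrt (k * (2 ^ numOnes k - 1)) := by
  -- Cauchy–Schwarz; the factor 3 is the square root of the 9 in `quadLebesgue_le`.
  have h1 := sq_sum_le_card_mul_sum_sq (s := range k) (f := fun j => ‖lagrangeEval e k j z‖)
  rw [card_range] at h1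
  have h2 := mul_le_mul_of_nonneg_left (quadLebesgue_le h k hz) (Nat.cast_nonneg (α := ℝ) k)
  have h3 : (3 : ℝ) = Real.sqrt 9 := by
    rw [show (9 : ℝ) = 3 ^ 2 by norm_num, Real.sqrt_sq (by norm_num)]
  rw [h3, ← Real.sqrt_mul (by norm_num)]
  refine Real.le_sqrt_of_sq_le (h1.trans (h2.trans_eq ?_))
  ring

/-! ### The interpolation operator -/

lemma interpolationOperator_apply (E : ℕ → closedUnitDisc) (k : ℕ) (f : C(closedUnitDisc, ℂ))
    (x : closedUnitDisc) : interpolationOperator E k f x =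
      (Lagrange.interpolate (range k) (fun i => (E i : ℂ)) fun i => f (E i)).eval (x : ℂ) := by
  simp [interpolationOperator, lagrangeFun, Lagrange.interpolate_apply, eval_finsetSum,
    ContinuousMap.sum_apply]

lemma lebesgueConstant_le (E : ℕ → closedUnitDisc) (k : ℕ) {M : ℝ} (hM : 0 ≤ M)
    (h : ∀ x : closedUnitDisc, ∑ j ∈ range k, ‖lagrangeEval (fun i => (E i : ℂ)) k j x‖ ≤ M) :
    lebesgueConstant E k ≤ M := by
  refine ContinuousLinearMap.opNorm_le_bound _ hM fun f => ?_
  rw [ContinuousMap.norm_le _ (by positivity)]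
  intro x
  rw [interpolationOperator_apply, Lagrange.interpolate_apply, eval_finsetSum]
  refine (norm_sum_le _ _).trans ?_
  refine le_trans ?_ (mul_le_mul_of_nonneg_right (h x) (norm_nonneg f))
  rw [sum_mul]
  refine sum_le_sum fun j _ => ?_
  rw [eval_mul, eval_C, norm_mul, mul_comm]
  exact mul_le_mul_of_nonneg_left (f.norm_coe_le_norm _) (norm_nonneg _)

/-- Multiplication by a point of the closed unit disc. -/
def discMul (a : closedUnitDisc) : C(closedUnitDisc, closedUnitDisc) where
  toFun x := ⟨a * x, by
    have ha := mem_closedBall_zero_iff.1 a.2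
    have hx := mem_closedBall_zero_iff.1 x.2
    rw [mem_closedBall_zero_iff, norm_mul]
    exact mul_le_one₀ ha (norm_nonneg _) hx⟩
  continuous_toFun := by fun_prop

lemma rootOfUnitySequence_coe (N j : ℕ) :
    (rootOfUnitySequence N j : ℂ) = Complex.exp (2 * Real.pi * Complex.I / N) ^ j := by
  rw [← Complex.exp_nat_mul]
  simp only [rootOfUnitySequence, circlePoint]
  congr 1
  push_cast
  ring

/-- The right side has degree at most `(m - 1) * N + (N - 1) < N * m`, so agreement at the nodes
suffices. At `e i` only `j = i / N` survives, and `e i / e (N * j)` is an `N`-th root of unity,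
hence a node of `w`. -/
lemma interpolate_eq_sum_comp {N m : ℕ} (hN : 0 < N) {e g : ℕ → ℂ} (he : Function.Injective e)
    (hg : Function.Injective g) (hg0 : ∀ j, g j ≠ 0) (heg : ∀ i, e i ^ N = g (i / N)) {w : ℕ → ℂ}
    (hw : Set.InjOn w (range N)) (hw' : ∀ ζ : ℂ, ζ ^ N = 1 → ∃ r < N, w r = ζ)
    (F : ℂ → ℂ) :
    Lagrange.interpolate (range (N * m)) e (fun i => F (e i)) =
      ∑ j ∈ range m, (Lagrange.basis (range m) g j).comp (X ^ N) *
        (Lagrange.interpolate (range N) w fun r => F (e (N * j) * w r)).comp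
          (C (e (N * j))⁻¹ * X) := by
  symm
  refine Lagrange.eq_interpolate_of_eval_eq _ he.injOn ?_ fun i hi => ?_
  · rw [card_range]
    rcases Nat.eq_zero_or_pos m with rfl | hm
    · simp
    rw [← mem_degreeLT]
    refine Submodule.sum_mem _ fun j hj => ?_
    rw [mem_degreeLT]
    have h1 : (Lagrange.basis (range m) g j).natDegree ≤ m - 1 := by
      refine natDegree_le_of_degree_le (Lagrange.degree_basis hg.injOn hj).le |>.trans_eq ?_
      rw [card_range]
    have h2 : (Lagrange.interpolate (range N) w fun r => F (e (N * j) * w r)).natDegree ≤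
        N - 1 := by
      refine natDegree_le_of_degree_le ((Lagrange.degree_interpolate_le _ hw).trans_eq ?_)
      rw [card_range]
    refine degree_le_natDegree.trans_lt (Nat.cast_lt.2 ?_)
    refine natDegree_mul_le.trans_lt ?_
    rw [natDegree_comp, natDegree_comp, natDegree_X_pow]
    have h3 : (C (e (N * j))⁻¹ * X : ℂ[X]).natDegree ≤ 1 :=
      (natDegree_C_mul_le _ _).trans natDegree_X_le
    have h4 := Nat.mul_le_mul_right N h1
    have h5 := Nat.mul_le_mul h2 h3
    have h6 : (m - 1) * N + N = N * m := by
      rw [← Nat.succ_mul, Nat.succ_eq_add_one, Nat.sub_add_cancel hm, mul_comm]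
    omega
  · rw [mem_range] at hi
    have him : i / N < m := Nat.div_lt_of_lt_mul hi
    have hgd : g (i / N) = e (N * (i / N)) ^ N := by
      rw [heg, Nat.mul_div_cancel_left _ hN]
    have he0 : e (N * (i / N)) ≠ 0 := fun h => hg0 (i / N) (by rw [hgd, h, zero_pow hN.ne'])
    rw [eval_finsetSum, sum_eq_single_of_mem (i / N) (mem_range.2 him)]
    · rw [eval_mul, eval_comp, eval_comp, eval_pow, eval_X, heg,
        Lagrange.eval_basis_self hg.injOn (mem_range.2 him), one_mul, eval_mul, eval_C, eval_X]
      obtain ⟨r, hr, hr'⟩ := hw' ((e (N * (i / N)))⁻¹ * e i) (by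
        rw [mul_pow, inv_pow, ← hgd, heg, inv_mul_cancel₀ (hg0 _)])
      rw [← hr', Lagrange.eval_interpolate_at_node _ hw (mem_range.2 hr), hr',
        mul_inv_cancel_left₀ he0]
    · intro j hj hne
      rw [eval_mul, eval_comp, eval_pow, eval_X, heg,
        Lagrange.eval_basis_of_ne hne (mem_range.2 him), zero_mul]

lemma lebesgueConstant_two_pow_mul_le {E : ℕ → closedUnitDisc}
    (h : IsComplexLeja fun i => (E i : ℂ)) (p m : ℕ) {M : ℝ} (hM : 0 ≤ M)
    (hM' : ∀ z : ℂ, ‖z‖ ≤ 1 →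
      ∑ j ∈ range m, ‖lagrangeEval (sqSeq^[p] fun i => (E i : ℂ)) m j z‖ ≤ M) :
    lebesgueConstant E (2 ^ p * m) ≤ M * lebesgueConstantRootsOfUnity (2 ^ p) := by
  have hL : 0 ≤ lebesgueConstantRootsOfUnity (2 ^ p) := norm_nonneg _
  refine ContinuousLinearMap.opNorm_le_bound _ (mul_nonneg hM hL) fun f => ?_
  rw [ContinuousMap.norm_le _ (by positivity)]
  intro x
  have hx : ‖(x : ℂ)‖ ≤ 1 := mem_closedBall_zero_iff.1 x.2
  have hN : 0 < 2 ^ p := by positivity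
  have hprim := Complex.isPrimitiveRoot_exp (2 ^ p) hN.ne'
  have hw : Set.InjOn (fun r => (rootOfUnitySequence (2 ^ p) r : ℂ)) (range (2 ^ p)) := by
    intro a ha b hb hab
    simp only [rootOfUnitySequence_coe] at hab
    exact hprim.pow_inj (mem_range.1 ha) (mem_range.1 hb) (by exact_mod_cast hab)
  have hw' : ∀ ζ : ℂ, ζ ^ 2 ^ p = 1 → ∃ r < 2 ^ p, (rootOfUnitySequence (2 ^ p) r : ℂ) = ζ := by
    intro ζ hζ
    have : NeZero (2 ^ p) := ⟨hN.ne'⟩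
    obtain ⟨r, hr, hr'⟩ := hprim.eq_pow_of_pow_eq_one hζ
    exact ⟨r, hr, by rw [rootOfUnitySequence_coe, ← hr']⟩
  have hg := h.iterate_sqSeq p
  -- The value 0 off the disc is immaterial: every node, and every rotated root of unity, lies in
  -- the disc.
  let F : ℂ → ℂ := Function.extend Subtype.val f 0
  have hFE : ∀ y : closedUnitDisc, F y = f y := fun y =>
    Subtype.val_injective.extend_apply f 0 y
  have key := interpolate_eq_sum_comp (m := m) hN h.injective hg.injective hg.isPaired.ne_zero
    (h.pow_two_pow p) hw hw' F
  simp only [hFE] at key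
  rw [interpolationOperator_apply, key, eval_finsetSum, mul_assoc]
  refine (norm_sum_le _ _).trans ?_
  have hxN : ‖(x : ℂ) ^ 2 ^ p‖ ≤ 1 := by rw [norm_pow]; exact pow_le_one₀ (norm_nonneg _) hx
  refine le_trans ?_ (mul_le_mul_of_nonneg_right (hM' _ hxN) (by positivity))
  rw [sum_mul]
  refine sum_le_sum fun j _ => ?_
  rw [eval_mul, norm_mul, eval_comp, eval_pow, eval_X]
  refine mul_le_mul_of_nonneg_left ?_ (norm_nonneg _)
  set a := E (2 ^ p * j) with ha
  have hna : ‖(a : ℂ)‖ = 1 := h.norm_eq (2 ^ p * j)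
  have hy : (a : ℂ)⁻¹ * x ∈ closedUnitDisc := by
    rw [mem_closedBall_zero_iff, norm_mul, norm_inv, hna]; simpa using hx
  -- The inner interpolant is the roots-of-unity operator applied to `f` composed with a rotation,
  -- which does not increase the sup norm.
  have h1 : ∀ r, F (a * rootOfUnitySequence (2 ^ p) r) =
      (f.comp (discMul a)) (rootOfUnitySequence (2 ^ p) r) := fun r =>
    hFE (discMul a (rootOfUnitySequence (2 ^ p) r))
  simp only [h1]
  have h2 := interpolationOperator_apply (rootOfUnitySequence (2 ^ p)) (2 ^ p)
    (f.comp (discMul a)) ⟨_, hy⟩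
  rw [eval_comp, eval_mul, eval_C, eval_X]
  dsimp only at h2
  rw [← h2]
  refine (ContinuousMap.norm_coe_le_norm _ _).trans ?_
  refine (ContinuousLinearMap.le_opNorm _ _).trans ?_
  refine mul_le_mul_of_nonneg_left ?_ (norm_nonneg _)
  rw [ContinuousMap.norm_le _ (norm_nonneg _)]
  exact fun y => f.norm_coe_le_norm _

/-! ### The two admissible families of sequences -/

lemma IsLejaSequence.isComplexLeja {E : ℕ → closedUnitDisc} (h : IsLejaSequence E) :
    IsComplexLeja fun i => (E i : ℂ) := by
  refine ⟨fun k => mem_closedBall_zero_iff.1 (E k).2, h.norm_zero, fun k x hx => ?_⟩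
  rcases Nat.eq_zero_or_pos k with rfl | hk
  · simp
  rw [norm_prod, norm_prod]
  exact h.isMax k hk ⟨x, mem_closedBall_zero_iff.2 hx⟩

/-- The digit sum defining the angles of `simpleLejaSequence`, over any long enough range. -/
lemma sum_digits_eq {k n : ℕ} (h : Nat.log 2 k + 1 ≤ n) :
    ∑ j ∈ range (Nat.log 2 k + 1), ((k / 2 ^ j % 2 : ℕ) : ℝ) / 2 ^ j =
      ∑ j ∈ range n, ((k / 2 ^ j % 2 : ℕ) : ℝ) / 2 ^ j := by
  refine sum_subset (range_mono h) fun j _ hj => ?_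
  rw [mem_range, not_lt] at hj
  rw [Nat.div_eq_of_lt (Nat.lt_pow_of_log_lt (by norm_num) (by omega))]
  simp

lemma sum_digits_two_mul_add {k r n : ℕ} (hr : r < 2) :
    ∑ j ∈ range (n + 1), (((2 * k + r) / 2 ^ j % 2 : ℕ) : ℝ) / 2 ^ j =
      (∑ j ∈ range n, ((k / 2 ^ j % 2 : ℕ) : ℝ) / 2 ^ j) / 2 + r := by
  rw [sum_range_succ', sum_div]
  congr 1
  · refine sum_congr rfl fun j _ => ?_
    rw [pow_succ', ← Nat.div_div_eq_div_mul, show (2 * k + r) / 2 = k by omega]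
    rw [div_div, pow_succ]
  · rw [pow_zero, Nat.div_one, show (2 * k + r) % 2 = r by omega]
    simp

lemma simpleLejaSequence_two_mul_add (k r : ℕ) (hr : r < 2) :
    (simpleLejaSequence (2 * k + r) : ℂ) = Complex.exp ((Real.pi *
      ((∑ j ∈ range (Nat.log 2 k + 1), ((k / 2 ^ j % 2 : ℕ) : ℝ) / 2 ^ j) / 2 + r) : ℝ) *
        Complex.I) := by
  have h : Nat.log 2 (2 * k + r) + 1 ≤ max (Nat.log 2 (2 * k + r)) (Nat.log 2 k + 1) + 1 := by
    omega
  simp only [simpleLejaSequence, circlePoint]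
  rw [sum_digits_eq h, sum_digits_two_mul_add hr, ← sum_digits_eq (le_max_right _ _)]

/-- Adding a unit digit rotates by `π`, and doubling `k` halves the angle. The sequence is thus
paired and fixed by `sqSeq`. -/
lemma isComplexLeja_simpleLejaSequence :
    IsComplexLeja fun i => (simpleLejaSequence i : ℂ) := by
  refine IsPaired.isComplexLeja ⟨fun k => ?_, fun k => ?_⟩ ?_
  · exact Complex.norm_exp_ofReal_mul_I _
  · have h0 := simpleLejaSequence_two_mul_add k 0 (by norm_num)
    have h1 := simpleLejaSequence_two_mul_add k 1 (by norm_num)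
    rw [add_zero] at h0
    rw [h0, h1, ← neg_one_mul, ← Complex.exp_pi_mul_I, ← Complex.exp_add]
    congr 1
    push_cast
    ring
  · funext k
    have h0 := simpleLejaSequence_two_mul_add k 0 (by norm_num)
    rw [add_zero] at h0
    rw [sqSeq, h0, ← Complex.exp_nat_mul]
    simp only [simpleLejaSequence, circlePoint]
    congr 1
    push_cast
    ring

theorem theorem2p9 (E : ℕ → closedUnitDisc) (hE : E = simpleLejaSequence ∨ IsLejaSequence E)
    (k : ℕ) (hk : 1 ≤ k) :
    lebesgueConstant E k ≤
        3 * Real.sqrt ((k : ℝ) / 2 ^ padicValNat 2 k * (2 ^ numOnes k - 1)) *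
          lebesgueConstantRootsOfUnity (2 ^ padicValNat 2 k) ∧
      lebesgueConstant E k ≤ 3 * Real.sqrt ((k : ℝ) * (2 ^ numOnes k - 1)) := by
  have h : IsComplexLeja fun i => (E i : ℂ) := by
    rcases hE with rfl | hE
    · exact isComplexLeja_simpleLejaSequence
    · exact hE.isComplexLeja
  constructor
  · obtain ⟨m, hm⟩ := pow_padicValNat_dvd (p := 2) (n := k)
    generalize padicValNat 2 k = p at hm ⊢
    subst hm
    refine lebesgueConstant_two_pow_mul_le h p m (by positivity) fun z hz => ?_
    refine (sum_norm_lagrangeEval_le (h.iterate_sqSeq p) m hz).trans_eq ?_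
    rw [numOnes_two_pow_mul]
    push_cast
    rw [mul_div_cancel_left₀ _ (by positivity)]
  · exact lebesgueConstant_le E k (by positivity) fun x =>
      sum_norm_lagrangeEval_le h k (mem_closedBall_zero_iff.1 x.2)
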